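/- A generalized continuum is a Hausdorff space that is connected (hence nonempty), locally connected, $\sigma$-compact and locally compact. A continuous map is proper if the preimage of every compact set is compact. A compact exhaustion of $X$ is a sequence of compact sets $K_0\subseteq K_1\subseteq\cdots$ covering $X$ with $K_i\subseteq \operatorname{int}K_{i+1}$ for all $i$. An end of $X$ with respect to $(K_i)$ is a sequence $\varepsilon=(W_0\supseteq W_1\supseteq\cdots)$ where $W_i$ is a connected component of $X\setminus K_i$ whose closure in $X$ is not compact. The end space $E(X)=E(X;(K_i))$ is the set of ends with the topology generated by the sets $\{\varepsilon : W_k=C\}$, where $k\ge 0$ and $C$ is a component of $X\setminus K_k$ with noncompact closure. A proper map $f:Y\to X$ of generalized continua induces a continuous map $E(f):E(Y;(L_i))\to E(X;(K_i))$ sending $(U_k)$ to the end whose $i$-th term is the component of $X\setminus K_i$, with noncompact closure, that contains $f(U_k)$ for all large $k$. Let $R$ be a PID with the discrete topology. Let $H^0_e(X)=\varinjlim_K H^0(X\setminus K;R)$, the direct limit of singular cohomology over the compact subsets $K\subseteq X$ ordered by inclusion, with its $R$-algebra structure given by the cup product; a proper map $f:Y\to X$ induces $f_e^*:H^0_e(X)\to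 H^0_e(Y)$ by sending the element represented by $a\in H^0(X\setminus K;R)$ to the element represented by $f^*(a)\in H^0(Y\setminus f^{-1}(K);R)$. Let $C(E(X),R)$ be the $R$-algebra of continuous functions $E(X)\to R$. Then for every metrizable generalized continuum $X$ and every compact exhaustion $(K_i)$ of $X$ there is an isomorphism of $R$-algebras $$\eta=\eta_{X,(K_i)}:H^0_e(X)\to C(E(X),R)$$ such that, for each singular $0$-cocycle $\varphi$ on $X\setminus K_i$, each end $\varepsilon=(W_0,W_1,\ldots)$ and each $x\in W_i$, the element of $H^0_e(X)$ represented by $\varphi$ is sent by $\eta$ to a function whose value at $\varepsilon$ is $\varphi(x)$. Moreover, $\eta$ is natural for proper maps: if $f:Y\to X$ is a proper map of metrizable generalized continua, then, for all compact exhaustions $(L_i)$ of $Y$ and $(K_i)$ of $X$, $$\eta_{Y,(L_i)}(f_e^*(a))=\eta_{X,(K_i)}(a)\circ E(f)\qquad\text{for all } a\in H^0_e(X).$$ That is, under the isomorphisms $\eta$, $f_e^*$ corresponds to the $R$-algebra morphism $C(E(X),R)\to C(E(Y),R)$, $\psi\mapsto\psi\circ E(f)$. -/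

import Mathlib

universe u v w

namespace EndTheory

open Set TopologicalSpace

/-! ### Generalized continua and proper maps -/

/-- A generalized continuum: a Hausdorff space that is connected (hence nonempty),
locally connected, `σ`-compact and locally compact. -/
class GeneralizedContinuum (X : Type u) [TopologicalSpace X] : Prop extends
  T2Space X, ConnectedSpace X, LocallyConnectedSpace X, SigmaCompactSpace X,
  LocallyCompactSpace X

/-- A continuous map is proper if the preimage of each compact set is compact. -/
def IsProper {Y : Type v} {X : Type u} [TopologicalSpace Y] [TopologicalSpace X]
    (f : C(Y, X)) : Prop :=
  ∀ K : Set X, IsCompact K → IsCompact (f ⁻¹' K)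

/-! ### Ends -/

/-- The unbounded components of a subspace `A` of `X`: the connected components of `A` whose
closure in `X` is not compact. -/
def unboundedComponents {X : Type u} [TopologicalSpace X] (A : Set X) : Set (Set X) :=
  {C | (∃ x ∈ A, C = connectedComponentIn A x) ∧ ¬ IsCompact (closure C)}

/-- The ends of `X` with respect to a compact exhaustion `K`: nested sequences
`W 0 ⊇ W 1 ⊇ ⋯`, where `W i` is an unbounded component of `X - K i`. -/
@[ext]
structure EndSpace {X : Type u} [TopologicalSpace X] (K : CompactExhaustion X) where
  /-- the `i`-th term of the end -/
  term : ℕ → Set X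
  term_mem : ∀ i, term i ∈ unboundedComponents (K i)ᶜ
  term_succ_subset : ∀ i, term (i + 1) ⊆ term i

namespace EndSpace

variable {X : Type u} [TopologicalSpace X] {Y : Type v} [TopologicalSpace Y]

/-- The set of ends whose `k`-th term equals `C`. -/
def basicOpen (K : CompactExhaustion X) (k : ℕ) (C : Set X) : Set (EndSpace K) :=
  {ε | ε.term k = C}

/-- The topology on the space of ends, generated by the sets `basicOpen K k C` with `C` an
unbounded component of `X - K k`. -/
instance (K : CompactExhaustion X) : TopologicalSpace (EndSpace K) :=
  generateFrom {U | ∃ k, ∃ C ∈ unboundedComponents (K k)ᶜ, U = basicOpen K k C}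

theorem term_subset_of_le {K : CompactExhaustion X} (ε : EndSpace K) {i j : ℕ} (h : i ≤ j) :
    ε.term j ⊆ ε.term i :=
  antitone_nat_of_succ_le (f := ε.term) ε.term_succ_subset h

theorem term_nonempty {K : CompactExhaustion X} (ε : EndSpace K) (i : ℕ) :
    (ε.term i).Nonempty := by
  obtain ⟨⟨x, hx, h⟩, -⟩ := ε.term_mem i
  exact h ▸ ⟨x, mem_connectedComponentIn hx⟩

theorem eq_of_mem_of_mem {A C D : Set X} {x : X} (hC : C ∈ unboundedComponents A)
    (hD : D ∈ unboundedComponents A) (hxC : x ∈ C) (hxD : x ∈ D) : C = D := by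
  obtain ⟨⟨y, hy, rfl⟩, -⟩ := hC
  obtain ⟨⟨z, hz, rfl⟩, -⟩ := hD
  rw [connectedComponentIn_eq hxC, connectedComponentIn_eq hxD]

/-- A proper map sends the terms of an end, from some index on, into one unbounded component of
the complement of a compact set. -/
theorem exists_image_subset [T2Space Y] (f : C(Y, X)) (hf : IsProper f)
    {L : CompactExhaustion Y} (ε : EndSpace L) {A : Set X} {k : ℕ}
    (hA : f ⁻¹' A ⊆ L k) :
    ∃ C ∈ unboundedComponents Aᶜ, f '' ε.term k ⊆ C := by
  obtain ⟨⟨y, hy, h⟩, hU⟩ := ε.term_mem k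
  have hyk : y ∈ ε.term k := h ▸ mem_connectedComponentIn hy
  have hsub : ε.term k ⊆ (L k)ᶜ := h ▸ connectedComponentIn_subset _ _
  have hpre : IsPreconnected (ε.term k) := h ▸ isPreconnected_connectedComponentIn
  have himg : f '' ε.term k ⊆ Aᶜ := by
    rintro _ ⟨z, hz, rfl⟩ hzA
    exact hsub hz (hA hzA)
  have hC : f '' ε.term k ⊆ connectedComponentIn Aᶜ (f y) :=
    (hpre.image f f.continuous.continuousOn).subset_connectedComponentIn
      (mem_image_of_mem f hyk) himg
  refine ⟨_, ⟨⟨f y, himg (mem_image_of_mem f hyk), rfl⟩, fun hc => hU ?_⟩, hC⟩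
  exact (hf _ hc).closure_of_subset fun z hz => subset_closure (hC (mem_image_of_mem f hz))

theorem exists_term [T2Space Y] (f : C(Y, X)) (hf : IsProper f) (L : CompactExhaustion Y)
    (K : CompactExhaustion X) (ε : EndSpace L) (i : ℕ) :
    ∃ C ∈ unboundedComponents (K i)ᶜ, ∃ k, f '' ε.term k ⊆ C := by
  obtain ⟨k, hk⟩ := L.exists_superset_of_isCompact (hf _ (K.isCompact i))
  obtain ⟨C, hC, h⟩ := exists_image_subset f hf ε hk
  exact ⟨C, hC, k, h⟩

theorem term_unique {L : CompactExhaustion Y} (f : C(Y, X)) (ε : EndSpace L) {A C D : Set X}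
    {k l : ℕ} (hC : C ∈ unboundedComponents A) (hD : D ∈ unboundedComponents A)
    (hk : f '' ε.term k ⊆ C) (hl : f '' ε.term l ⊆ D) : C = D := by
  obtain ⟨y, hy⟩ := ε.term_nonempty (max k l)
  exact eq_of_mem_of_mem hC hD
    (hk (mem_image_of_mem f (ε.term_subset_of_le (le_max_left k l) hy)))
    (hl (mem_image_of_mem f (ε.term_subset_of_le (le_max_right k l) hy)))

/-- The function underlying the induced map on ends: the `i`-th term of the image of `ε` is the
unique unbounded component of `X - K i` that contains `f (ε.term k)` for some (equivalently, each
large) `k`. -/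
noncomputable def mapFun [T2Space Y] (f : C(Y, X)) (hf : IsProper f) (L : CompactExhaustion Y)
    (K : CompactExhaustion X) (ε : EndSpace L) : EndSpace K where
  term i := (exists_term f hf L K ε i).choose
  term_mem i := (exists_term f hf L K ε i).choose_spec.1
  term_succ_subset i := by
    obtain ⟨⟨⟨x, hx, hCx⟩, hU⟩, k, hk⟩ := (exists_term f hf L K ε (i + 1)).choose_spec
    obtain ⟨⟨⟨z, hz, hDz⟩, hV⟩, l, hl⟩ := (exists_term f hf L K ε i).choose_spec
    obtain ⟨y, hy⟩ := ε.term_nonempty (max k l)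
    have h1 := hk (mem_image_of_mem f (ε.term_subset_of_le (le_max_left k l) hy))
    have h2 := hl (mem_image_of_mem f (ε.term_subset_of_le (le_max_right k l) hy))
    rw [hCx] at h1 ⊢
    rw [hDz] at h2 ⊢
    rw [connectedComponentIn_eq h1, connectedComponentIn_eq h2]
    exact connectedComponentIn_mono _ (compl_subset_compl.2 (K.subset_succ i))

/-- If `f ⁻¹ (K i) ⊆ L k`, then `f` maps the `k`-th term of an end of `Y` into the `i`-th term of
its image; this determines the image. -/
theorem image_term_subset [T2Space Y] (f : C(Y, X)) (hf : IsProper f) (L : CompactExhaustion Y)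
    (K : CompactExhaustion X) (ε : EndSpace L) {i k : ℕ} (h : f ⁻¹' K i ⊆ L k) :
    f '' ε.term k ⊆ (mapFun f hf L K ε).term i := by
  obtain ⟨C, hC, hk⟩ := exists_image_subset f hf ε h
  obtain ⟨hD, l, hl⟩ := (exists_term f hf L K ε i).choose_spec
  have e : C = (mapFun f hf L K ε).term i := term_unique f ε hC hD hk hl
  exact e ▸ hk

theorem continuous_mapFun [T2Space Y] (f : C(Y, X)) (hf : IsProper f) (L : CompactExhaustion Y)
    (K : CompactExhaustion X) : Continuous (mapFun f hf L K) := by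
  refine continuous_generateFrom_iff.2 ?_
  rintro _ ⟨i, C, hC, rfl⟩
  obtain ⟨k, hk⟩ := L.exists_superset_of_isCompact (hf _ (K.isCompact i))
  have : mapFun f hf L K ⁻¹' basicOpen K i C =
      ⋃ D ∈ {D | D ∈ unboundedComponents (L k)ᶜ ∧ f '' D ⊆ C}, basicOpen L k D := by
    ext ε
    simp only [mem_preimage, mem_iUnion, basicOpen, mem_ofPred_eq, exists_prop]
    constructor
    · rintro rfl
      exact ⟨_, ⟨ε.term_mem k, image_term_subset f hf L K ε hk⟩, rfl⟩
    · rintro ⟨D, ⟨-, hD⟩, rfl⟩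
      exact term_unique f ε ((mapFun f hf L K ε).term_mem i) hC
        (image_term_subset f hf L K ε hk) hD
  rw [this]
  exact isOpen_biUnion fun D hD => isOpen_generateFrom_of_mem ⟨k, D, hD.1, rfl⟩

/-- The map `E(f) : E(Y) → E(X)` on end spaces induced by a proper map `f : Y → X`, for any choice
of compact exhaustions of `Y` and `X`. -/
noncomputable def map [T2Space Y] (f : C(Y, X)) (hf : IsProper f) (L : CompactExhaustion Y)
    (K : CompactExhaustion X) : C(EndSpace L, EndSpace K) :=
  ⟨mapFun f hf L K, continuous_mapFun f hf L K⟩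

end EndSpace

/-! ### Singular cohomology -/

/-- Singular `k`-simplices of `X`. -/
abbrev SingularSimplex (X : Type u) [TopologicalSpace X] (k : ℕ) : Type u :=
  C(stdSimplex ℝ (Fin (k + 1)), X)

/-- The affine map between standard simplices induced by a map of their vertices. -/
noncomputable def vertexMap {m n : ℕ} (g : Fin m → Fin n) :
    C(stdSimplex ℝ (Fin m), stdSimplex ℝ (Fin n)) :=
  ⟨stdSimplex.map g, stdSimplex.continuous_map g⟩

section Cohomology

variable (R : Type w) [CommRing R]
variable {X : Type u} [TopologicalSpace X] {Y : Type v} [TopologicalSpace Y]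
variable {Z : Type*} [TopologicalSpace Z]

/-- Singular `k`-cochains of `X` with coefficients in `R`. -/
abbrev Cochain (X : Type u) [TopologicalSpace X] (k : ℕ) : Type (max u w) :=
  SingularSimplex X k → R

/-- The singular coboundary
`(δ φ) σ = ∑ i, (-1) ^ i * φ (σ restricted to the i-th face)`. -/
noncomputable def coboundary (X : Type u) [TopologicalSpace X] (k : ℕ) :
    Cochain R X k →ₗ[R] Cochain R X (k + 1) where
  toFun φ σ := ∑ i : Fin (k + 2), (-1) ^ (i : ℕ) * φ (σ.comp (vertexMap i.succAbove))
  map_add' φ ψ := by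
    ext σ
    simp [mul_add, Finset.sum_add_distrib]
  map_smul' r φ := by
    ext σ
    simp [Finset.mul_sum, mul_left_comm]

/-- Singular `k`-cocycles. -/
noncomputable def cocycles (X : Type u) [TopologicalSpace X] (k : ℕ) :
    Submodule R (Cochain R X k) :=
  LinearMap.ker (coboundary R X k)

/-- Singular `k`-coboundaries. -/
noncomputable def coboundaries (X : Type u) [TopologicalSpace X] :
    (k : ℕ) → Submodule R (Cochain R X k)
  | 0 => ⊥
  | k + 1 => LinearMap.range (coboundary R X k)

/-- The `k`-th singular cohomology `H^k(X; R)`: cocycles modulo coboundaries. -/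
def Cohomology (X : Type u) [TopologicalSpace X] (k : ℕ) : Type (max u w) :=
  cocycles R X k ⧸ (coboundaries R X k).comap (cocycles R X k).subtype

noncomputable instance (X : Type u) [TopologicalSpace X] (k : ℕ) :
    AddCommGroup (Cohomology R X k) :=
  inferInstanceAs (AddCommGroup
    (cocycles R X k ⧸ (coboundaries R X k).comap (cocycles R X k).subtype))

noncomputable instance (X : Type u) [TopologicalSpace X] (k : ℕ) : Module R (Cohomology R X k) :=
  inferInstanceAs (Module R
    (cocycles R X k ⧸ (coboundaries R X k).comap (cocycles R X k).subtype))

/-- The cohomology class of a cocycle. -/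
noncomputable def cohomologyClass (X : Type u) [TopologicalSpace X] (k : ℕ) :
    cocycles R X k →ₗ[R] Cohomology R X k :=
  Submodule.mkQ ((coboundaries R X k).comap (cocycles R X k).subtype)

theorem cohomologyClass_surjective (X : Type u) [TopologicalSpace X] (k : ℕ) :
    Function.Surjective (cohomologyClass R X k) :=
  Submodule.mkQ_surjective _

/-- The map induced on cochains by a continuous map. -/
noncomputable def cochainMap (f : C(Y, X)) (k : ℕ) : Cochain R X k →ₗ[R] Cochain R Y k where
  toFun φ σ := φ (f.comp σ)
  map_add' _ _ := rfl
  map_smul' _ _ := rfl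

theorem coboundary_cochainMap (f : C(Y, X)) (k : ℕ) (φ : Cochain R X k) :
    coboundary R Y k (cochainMap R f k φ) = cochainMap R f (k + 1) (coboundary R X k φ) :=
  rfl

theorem cochainMap_mem_cocycles (f : C(Y, X)) (k : ℕ) (φ : Cochain R X k)
    (h : φ ∈ cocycles R X k) : cochainMap R f k φ ∈ cocycles R Y k := by
  have h' : coboundary R X k φ = 0 := h
  change coboundary R Y k _ = 0
  rw [coboundary_cochainMap, h', map_zero]

theorem cochainMap_mem_coboundaries (f : C(Y, X)) : (k : ℕ) → (φ : Cochain R X k) →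
    φ ∈ coboundaries R X k → cochainMap R f k φ ∈ coboundaries R Y k
  | 0, φ, h => by
    obtain rfl : φ = 0 := h
    exact Submodule.zero_mem _
  | k + 1, φ, h => by
    obtain ⟨ψ, rfl⟩ := h
    exact ⟨cochainMap R f k ψ, coboundary_cochainMap R f k ψ⟩

/-- The map `f^* : H^k(X; R) → H^k(Y; R)` induced by a continuous map `f : Y → X`. -/
noncomputable def cohomologyMap (f : C(Y, X)) (k : ℕ) :
    Cohomology R X k →ₗ[R] Cohomology R Y k :=
  Submodule.mapQ ((coboundaries R X k).comap (cocycles R X k).subtype)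
    ((coboundaries R Y k).comap (cocycles R Y k).subtype)
    ((cochainMap R f k).restrict (cochainMap_mem_cocycles R f k))
    fun φ h => cochainMap_mem_coboundaries R f k φ.1 h

/-! ### The cup product in dimension zero -/

variable {R} in
/-- The cup product of singular cochains: evaluate on the front `k`-face and the back `l`-face. -/
noncomputable def cup {k l : ℕ} (φ : Cochain R X k) (ψ : Cochain R X l) : Cochain R X (k + l) :=
  fun σ =>
    φ (σ.comp (vertexMap (Fin.castLE (show k + 1 ≤ k + l + 1 by omega)))) *
    ψ (σ.comp (vertexMap (fun j : Fin (l + 1) =>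
      (Fin.natAdd k j : Fin (k + (l + 1))))))

theorem vertexMap_self {m : ℕ} (g : Fin m → Fin m) (h : ∀ i, g i = i) :
    vertexMap g = ContinuousMap.id _ := by
  obtain rfl : g = id := funext h
  ext1 x
  exact stdSimplex.map_id_apply x

variable {R} in
theorem cup_zero_zero (φ ψ : Cochain R X 0) : cup φ ψ = φ * ψ := by
  funext σ
  have h1 := vertexMap_self (Fin.castLE (show 0 + 1 ≤ 0 + 0 + 1 by omega))
    (fun i => Subsingleton.elim (α := Fin 1) _ _)
  have h2 := vertexMap_self (fun j : Fin (0 + 1) => (Fin.natAdd 0 j : Fin (0 + (0 + 1))))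
    (fun i => Subsingleton.elim (α := Fin 1) _ _)
  simp only [cup]
  erw [h1, h2]
  rfl

theorem mem_cocycles_zero_iff (φ : Cochain R X 0) :
    φ ∈ cocycles R X 0 ↔ ∀ σ : SingularSimplex X 1,
      φ (σ.comp (vertexMap (Fin.succAbove 0))) = φ (σ.comp (vertexMap (Fin.succAbove 1))) := by
  change coboundary R X 0 φ = 0 ↔ _
  rw [funext_iff]
  refine forall_congr' fun σ => ?_
  simp [coboundary, Fin.sum_univ_succ, ← sub_eq_add_neg, sub_eq_zero]

theorem cup_mem_cocycles_zero {φ ψ : Cochain R X 0} (hφ : φ ∈ cocycles R X 0)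
    (hψ : ψ ∈ cocycles R X 0) : (cup φ ψ : Cochain R X 0) ∈ cocycles R X 0 := by
  rw [mem_cocycles_zero_iff] at *
  intro σ
  rw [cup_zero_zero]
  simp only [Pi.mul_apply, hφ σ, hψ σ]

theorem one_mem_cocycles_zero : (1 : Cochain R X 0) ∈ cocycles R X 0 := by
  rw [mem_cocycles_zero_iff]
  intro σ
  rfl

/-- The cup product `H^0(X; R) × H^0(X; R) → H^0(X; R)`. -/
noncomputable instance : Mul (Cohomology R X 0) where
  mul := Quotient.map₂
    (sa := ((coboundaries R X 0).comap (cocycles R X 0).subtype).quotientRel)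
    (sb := ((coboundaries R X 0).comap (cocycles R X 0).subtype).quotientRel)
    (sc := ((coboundaries R X 0).comap (cocycles R X 0).subtype).quotientRel)
    (fun φ ψ => ⟨cup φ.1 ψ.1, cup_mem_cocycles_zero R φ.2 ψ.2⟩) (by
      intro a b hab c d hcd
      obtain rfl : a = b :=
        sub_eq_zero.1 (Subtype.ext ((Submodule.quotientRel_def _).1 hab))
      obtain rfl : c = d :=
        sub_eq_zero.1 (Subtype.ext ((Submodule.quotientRel_def _).1 hcd))
      exact ((coboundaries R X 0).comap (cocycles R X 0).subtype).quotientRel.refl _)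

/-- The unit of `H^0(X; R)`: the class of the constant cochain `1`. -/
noncomputable instance : One (Cohomology R X 0) where
  one := cohomologyClass R X 0 ⟨1, one_mem_cocycles_zero R⟩

theorem mk_mul_mk (φ ψ : cocycles R X 0) :
    cohomologyClass R X 0 φ * cohomologyClass R X 0 ψ =
      cohomologyClass R X 0 ⟨cup φ.1 ψ.1, cup_mem_cocycles_zero R φ.2 ψ.2⟩ :=
  rfl

theorem mk_mul_mk' (φ ψ : cocycles R X 0) (h : φ.1 * ψ.1 ∈ cocycles R X 0) :
    cohomologyClass R X 0 φ * cohomologyClass R X 0 ψ =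
      cohomologyClass R X 0 ⟨φ.1 * ψ.1, h⟩ := by
  rw [mk_mul_mk]
  congr 1
  exact Subtype.ext (cup_zero_zero _ _)

theorem mul_mem_cocycles_zero (φ ψ : cocycles R X 0) : φ.1 * ψ.1 ∈ cocycles R X 0 :=
  cup_zero_zero φ.1 ψ.1 ▸ cup_mem_cocycles_zero R φ.2 ψ.2

/-- `H^0(X; R)` is a commutative ring under the cup product. -/
noncomputable instance : CommRing (Cohomology R X 0) where
  __ := (inferInstance : AddCommGroup (Cohomology R X 0))
  mul := (· * ·)
  one := 1
  zero_mul a := by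
    obtain ⟨φ, rfl⟩ := cohomologyClass_surjective R _ 0 a
    exact (mk_mul_mk' R 0 φ (mul_mem_cocycles_zero R 0 φ)).trans
      (congrArg (cohomologyClass R X 0) (Subtype.ext (zero_mul _)))
  mul_zero a := by
    obtain ⟨φ, rfl⟩ := cohomologyClass_surjective R _ 0 a
    exact (mk_mul_mk' R φ 0 (mul_mem_cocycles_zero R φ 0)).trans
      (congrArg (cohomologyClass R X 0) (Subtype.ext (mul_zero _)))
  one_mul a := by
    obtain ⟨φ, rfl⟩ := cohomologyClass_surjective R _ 0 a
    exact (mk_mul_mk' R ⟨1, one_mem_cocycles_zero R⟩ φ (mul_mem_cocycles_zero R _ φ)).trans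
      (congrArg (cohomologyClass R X 0) (Subtype.ext (one_mul _)))
  mul_one a := by
    obtain ⟨φ, rfl⟩ := cohomologyClass_surjective R _ 0 a
    exact (mk_mul_mk' R φ ⟨1, one_mem_cocycles_zero R⟩ (mul_mem_cocycles_zero R φ _)).trans
      (congrArg (cohomologyClass R X 0) (Subtype.ext (mul_one _)))
  mul_comm a b := by
    obtain ⟨φ, rfl⟩ := cohomologyClass_surjective R _ 0 a
    obtain ⟨ψ, rfl⟩ := cohomologyClass_surjective R _ 0 b
    rw [mk_mul_mk' R φ ψ (mul_mem_cocycles_zero R _ _),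
      mk_mul_mk' R ψ φ (mul_mem_cocycles_zero R _ _)]
    exact congrArg (cohomologyClass R X 0) (Subtype.ext (mul_comm _ _))
  mul_assoc a b c := by
    obtain ⟨φ, rfl⟩ := cohomologyClass_surjective R _ 0 a
    obtain ⟨ψ, rfl⟩ := cohomologyClass_surjective R _ 0 b
    obtain ⟨χ, rfl⟩ := cohomologyClass_surjective R _ 0 c
    rw [mk_mul_mk' R φ ψ (mul_mem_cocycles_zero R _ _),
      mk_mul_mk' R ψ χ (mul_mem_cocycles_zero R _ _),
      mk_mul_mk' R _ χ (mul_mem_cocycles_zero R _ _),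
      mk_mul_mk' R φ _ (mul_mem_cocycles_zero R _ _)]
    exact congrArg (cohomologyClass R X 0) (Subtype.ext (mul_assoc _ _ _))
  left_distrib a b c := by
    obtain ⟨φ, rfl⟩ := cohomologyClass_surjective R _ 0 a
    obtain ⟨ψ, rfl⟩ := cohomologyClass_surjective R _ 0 b
    obtain ⟨χ, rfl⟩ := cohomologyClass_surjective R _ 0 c
    rw [← map_add, mk_mul_mk' R φ ψ (mul_mem_cocycles_zero R _ _),
      mk_mul_mk' R φ χ (mul_mem_cocycles_zero R _ _),
      mk_mul_mk' R φ _ (mul_mem_cocycles_zero R _ _), ← map_add]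
    exact congrArg (cohomologyClass R X 0) (Subtype.ext (mul_add _ _ _))
  right_distrib a b c := by
    obtain ⟨φ, rfl⟩ := cohomologyClass_surjective R _ 0 a
    obtain ⟨ψ, rfl⟩ := cohomologyClass_surjective R _ 0 b
    obtain ⟨χ, rfl⟩ := cohomologyClass_surjective R _ 0 c
    rw [← map_add, mk_mul_mk' R φ χ (mul_mem_cocycles_zero R _ _),
      mk_mul_mk' R ψ χ (mul_mem_cocycles_zero R _ _),
      mk_mul_mk' R _ χ (mul_mem_cocycles_zero R _ _), ← map_add]
    exact congrArg (cohomologyClass R X 0) (Subtype.ext (add_mul _ _ _))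

theorem smul_mul_zero (r : R) (a b : Cohomology R X 0) : r • a * b = r • (a * b) := by
  obtain ⟨φ, rfl⟩ := cohomologyClass_surjective R _ 0 a
  obtain ⟨ψ, rfl⟩ := cohomologyClass_surjective R _ 0 b
  rw [← map_smul, mk_mul_mk' R φ ψ (mul_mem_cocycles_zero R _ _),
    mk_mul_mk' R _ ψ (mul_mem_cocycles_zero R _ _), ← map_smul]
  exact congrArg (cohomologyClass R X 0) (Subtype.ext (smul_mul_assoc _ _ _))

/-- `H^0(X; R)` is an `R`-algebra. -/
noncomputable instance : Algebra R (Cohomology R X 0) :=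
  Algebra.ofModule (smul_mul_zero R)
    (fun r a b => by rw [mul_comm, smul_mul_zero, mul_comm])

/-- In dimension zero, `f^*` is a morphism of `R`-algebras. -/
noncomputable def cohomologyMapZero (f : C(Y, X)) : Cohomology R X 0 →ₐ[R] Cohomology R Y 0 :=
  AlgHom.ofLinearMap (cohomologyMap R f 0) rfl (by
    intro a b
    obtain ⟨φ, rfl⟩ := cohomologyClass_surjective R _ 0 a
    obtain ⟨ψ, rfl⟩ := cohomologyClass_surjective R _ 0 b
    rfl)

theorem cohomologyMapZero_id (a : Cohomology R X 0) :
    cohomologyMapZero R (ContinuousMap.id X) a = a := by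
  obtain ⟨φ, rfl⟩ := cohomologyClass_surjective R _ 0 a
  rfl

theorem cohomologyMapZero_comp (f : C(Y, X)) (g : C(Z, Y)) (a : Cohomology R X 0) :
    cohomologyMapZero R g (cohomologyMapZero R f a) = cohomologyMapZero R (f.comp g) a := by
  obtain ⟨φ, rfl⟩ := cohomologyClass_surjective R _ 0 a
  rfl

/-! ### End cohomology in dimension zero -/

/-- The restriction `A → B` of a continuous map `f : Y → X` with `f(A) ⊆ B`. -/
def restrictMap (f : C(Y, X)) {A : Set Y} {B : Set X} (h : MapsTo f A B) : C(A, B) :=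
  ⟨h.restrict, f.continuous.restrict h⟩

/-- For compact sets `K ⊆ L`, the restriction `H^0(X - K; R) → H^0(X - L; R)`. -/
noncomputable def restriction (X : Type u) [TopologicalSpace X] (K L : Compacts X) (h : K ≤ L) :
    Cohomology R ↥(K : Set X)ᶜ 0 →ₐ[R] Cohomology R ↥(L : Set X)ᶜ 0 :=
  cohomologyMapZero R (restrictMap (ContinuousMap.id X) (compl_subset_compl.2 h))

instance (X : Type u) [TopologicalSpace X] :
    DirectedSystem (fun K : Compacts X => Cohomology R ↥(K : Set X)ᶜ 0)
      (fun K L h => restriction R X K L h) where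
  map_self _ a := cohomologyMapZero_id R a
  map_map _ _ _ _ _ a := cohomologyMapZero_comp R _ _ a

/-- The zero-dimensional end cohomology `H_e^0(X; R)`: the direct limit of `H^0(X - K; R)` over
the compact sets `K` of `X`, ordered by inclusion. -/
abbrev EndCohomologyZero (X : Type u) [TopologicalSpace X] : Type (max u w) :=
  DirectLimit (fun K : Compacts X => Cohomology R ↥(K : Set X)ᶜ 0)
    (fun K L h => restriction R X K L h)

/-- The canonical morphism `H^0(X - K; R) → H_e^0(X; R)`. -/
noncomputable def toEnd (X : Type u) [TopologicalSpace X] (K : Compacts X) :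
    Cohomology R ↥(K : Set X)ᶜ 0 →ₐ[R] EndCohomologyZero R X :=
  AlgHom.ofLinearMap
    (DirectLimit.Module.of R (Compacts X) (fun K : Compacts X => Cohomology R ↥(K : Set X)ᶜ 0)
      (fun K L h => restriction R X K L h) K)
    (DirectLimit.one_def (G := fun K : Compacts X => Cohomology R ↥(K : Set X)ᶜ 0)
      (f := fun K L h => restriction R X K L h) K).symm
    (fun a b => (DirectLimit.mul_def (G := fun K : Compacts X => Cohomology R ↥(K : Set X)ᶜ 0)
      (f := fun K L h => restriction R X K L h) K a b).symm)

theorem toEnd_restriction (X : Type u) [TopologicalSpace X] (K L : Compacts X) (h : K ≤ L)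
    (a : Cohomology R ↥(K : Set X)ᶜ 0) : toEnd R X L (restriction R X K L h a) = toEnd R X K a :=
  DirectLimit.Module.of_f (R := R) (ι := Compacts X)
    (G := fun K : Compacts X => Cohomology R ↥(K : Set X)ᶜ 0)
    (f := fun K L h => restriction R X K L h) (hij := h)

/-- The preimage of a compact set under a proper map. -/
def preimageCompacts (f : C(Y, X)) (hf : IsProper f) (K : Compacts X) : Compacts Y :=
  ⟨f ⁻¹' K, hf K K.isCompact⟩

/-- The map `H^0(X - K; R) → H^0(Y - f⁻¹(K); R)` induced by the restriction of `f`. -/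
noncomputable def complMap (f : C(Y, X)) (hf : IsProper f) (K : Compacts X) :
    Cohomology R ↥(K : Set X)ᶜ 0 →ₐ[R] Cohomology R ↥(preimageCompacts f hf K : Set Y)ᶜ 0 :=
  cohomologyMapZero R (restrictMap f (A := (preimageCompacts f hf K : Set Y)ᶜ)
    (B := (K : Set X)ᶜ) fun _ h => h)

/-- The morphism `f_e^* : H_e^0(X; R) → H_e^0(Y; R)` induced by a proper map `f : Y → X`. It sends
the element represented by `a ∈ H^0(X - K; R)` to the element represented by
`f^*(a) ∈ H^0(Y - f⁻¹(K); R)`. -/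
noncomputable def endCohomologyMap (f : C(Y, X)) (hf : IsProper f) :
    EndCohomologyZero R X →ₐ[R] EndCohomologyZero R Y :=
  let F : EndCohomologyZero R X →ₗ[R] EndCohomologyZero R Y :=
    DirectLimit.Module.lift R (Compacts X)
      (fun K : Compacts X => Cohomology R ↥(K : Set X)ᶜ 0) (fun K L h => restriction R X K L h)
      (fun K => ((toEnd R Y (preimageCompacts f hf K)).comp (complMap R f hf K)).toLinearMap)
      (fun K L h a => by
        have hle : preimageCompacts f hf K ≤ preimageCompacts f hf L := fun y hy => h hy
        have e : complMap R f hf L (restriction R X K L h a) =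
            restriction R Y _ _ hle (complMap R f hf K a) := by
          unfold complMap restriction
          rw [cohomologyMapZero_comp, cohomologyMapZero_comp]
          rfl
        change toEnd R Y _ (complMap R f hf L (restriction R X K L h a)) =
          toEnd R Y _ (complMap R f hf K a)
        rw [e, toEnd_restriction])
  have hF : ∀ K a, F (toEnd R X K a) =
    toEnd R Y (preimageCompacts f hf K) (complMap R f hf K a) := fun _ _ => rfl
  AlgHom.ofLinearMap F
    (by rw [← map_one (toEnd R X ⊥), hF, map_one, map_one])
    (fun x y => DirectLimit.induction₂ _ (fun K a b => by
        change F (toEnd R X K a * toEnd R X K b) = F (toEnd R X K a) * F (toEnd R X K b)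
        rw [← map_mul, hF, hF, hF, map_mul, map_mul]) x y)

theorem endCohomologyMap_toEnd (f : C(Y, X)) (hf : IsProper f) (K : Compacts X)
    (a : Cohomology R ↥(K : Set X)ᶜ 0) :
    endCohomologyMap R f hf (toEnd R X K a) =
      toEnd R Y (preimageCompacts f hf K) (complMap R f hf K a) :=
  rfl

end Cohomology

/-- The `i`-th compact set of a compact exhaustion. -/
def exhaustionCompact {X : Type u} [TopologicalSpace X] (K : CompactExhaustion X) (i : ℕ) :
    Compacts X :=
  ⟨K i, K.isCompact i⟩

/-- The value of a singular `0`-cochain at a point. -/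
def valueAt {R : Type w} {X : Type u} [TopologicalSpace X] (φ : Cochain R X 0) (x : X) : R :=
  φ (ContinuousMap.const _ x)

end EndTheory

/-! A degree-zero cocycle is a function on points that takes equal values at the two endpoints of
every path, and there are no nonzero coboundaries in degree zero. So a class in `H^0(X - A)` is the
same as a function on `X - A` constant on path components. Along an end `ε` the terms of large index
lie outside `A`. If they are path-connected, the class has a single value on them, and this value
defines `η` at `ε`.

The analytic input is that the terms, which are connected and open, are path-connected. A locally
connected, locally compact metrizable space is locally path-connected
(`locallyPathConnectedSpace_of_metrizableSpace`). The path is a uniform limit of finer and finer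
chains of small connected open sets, and it exists because compact neighbourhoods are complete
(`joinedIn_of_isComplete`).

The topological input concerns the components of `X - K i`. All but finitely many lie in `K (i +
1)`, because the others, unless one is all of `X`, meet the compact frontier of `K (i + 1)`
(`finite_components_not_subset`). Hence there are finitely many unbounded components, the bounded
ones have relatively compact union, and each unbounded component extends to an end
(`EndSpace.exists_term_eq`).

Injectivity: a class vanishing at all ends vanishes on every unbounded component of some `X - K i`,
hence everywhere off a larger compact set. Surjectivity: the end space is compact, so a continuous
function to a discrete ring depends only on the `i`-th term for some `i`; extending it by zero to
the bounded components of `X - K i` gives a cocycle. Naturality holds because both sides evaluate a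
class at the same point `f y`. -/

namespace EndTheory

open Set TopologicalSpace

/-! ### Local path-connectedness -/

section PathConnected

open Filter Topology

/-- Two points lie in a common connected open subset of `U` of diameter at most `ε`. -/
def Linked {X : Type*} [MetricSpace X] (U : Set X) (ε : ℝ) (a b : X) : Prop :=
  ∃ C, IsOpen C ∧ IsPreconnected C ∧ C ⊆ U ∧ a ∈ C ∧ b ∈ C ∧ ∀ c ∈ C, ∀ d ∈ C, dist c d ≤ ε

/-- A sequence of points whose consecutive terms are linked and which is constant, equal to `y`,
from the index `N` on. -/
def LinkedChain {X : Type*} [MetricSpace X] (U : Set X) (ε : ℝ) (y : X) (N : ℕ)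
    (p : ℕ → X) : Prop :=
  (∀ j, Linked U ε (p j) (p (j + 1))) ∧ ∀ j, N ≤ j → p j = y

variable {X : Type*} [MetricSpace X] {U V : Set X} {ε : ℝ} {a b x y z : X}

theorem Linked.symm (h : Linked U ε a b) : Linked U ε b a := by
  obtain ⟨C, ho, hc, hU, ha, hb, hd⟩ := h
  exact ⟨C, ho, hc, hU, hb, ha, hd⟩

theorem Linked.mono (h : Linked U ε a b) (hUV : U ⊆ V) : Linked V ε a b := by
  obtain ⟨C, ho, hc, hU, ha, hb, hd⟩ := h
  exact ⟨C, ho, hc, hU.trans hUV, ha, hb, hd⟩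

theorem Linked.refl_left (h : Linked U ε a b) : Linked U ε a a := by
  obtain ⟨C, ho, hc, hU, ha, -, hd⟩ := h
  exact ⟨C, ho, hc, hU, ha, ha, hd⟩

theorem Linked.mem_left (h : Linked U ε a b) : a ∈ U := by
  obtain ⟨C, -, -, hU, ha, -, -⟩ := h
  exact hU ha

theorem Linked.dist_le (h : Linked U ε a b) : dist a b ≤ ε := by
  obtain ⟨C, -, -, -, ha, hb, hd⟩ := h
  exact hd a ha b hb

/-! ### Chains of small connected open sets, their refinements, and the limit path. -/

theorem eventually_linked [LocallyConnectedSpace X] (hU : IsOpen U) (hx : x ∈ U) (hε : 0 < ε) :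
    ∀ᶠ y in 𝓝 x, Linked U ε x y := by
  obtain ⟨C, hC, ho, hxC, hc⟩ := locallyConnectedSpace_iff_subsets_isOpen_isConnected.1
    ‹_› x (U ∩ Metric.ball x (ε / 2))
    (inter_mem (hU.mem_nhds hx) (Metric.ball_mem_nhds x (half_pos hε)))
  filter_upwards [ho.mem_nhds hxC] with y hy
  refine ⟨C, ho, hc.isPreconnected, hC.trans inter_subset_left, hxC, hy, fun c hcC d hdC => ?_⟩
  have h1 := Metric.mem_ball.1 (hC hcC).2
  have h2 := Metric.mem_ball.1 (hC hdC).2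
  linarith [dist_triangle_right c d x]

theorem LinkedChain.trans {N M : ℕ} {p q : ℕ → X} (hp : LinkedChain U ε y N p)
    (hq : LinkedChain U ε z M q) (hq0 : q 0 = y) :
    LinkedChain U ε z (N + M) (fun i => if i < N then p i else q (i - N)) := by
  refine ⟨fun j => ?_, fun j hj => ?_⟩
  · rcases lt_trichotomy (j + 1) N with h | h | h
    · simpa [h, (Nat.lt_succ_self j).trans h] using hp.1 j
    · have h1 : j < N := by omega
      have h2 := hp.1 j
      rw [hp.2 (j + 1) h.ge, ← hq0] at h2
      simpa [h, h1] using h2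
    · have h1 : ¬ j < N := by omega
      have h2 : ¬ j + 1 < N := by omega
      have h3 : j + 1 - N = j - N + 1 := by omega
      simpa only [h1, h2, if_false, h3] using hq.1 (j - N)
  · have h1 : ¬ j < N := by omega
    simpa only [h1, if_false] using hq.2 (j - N) (by omega)

theorem LinkedChain.symm {N : ℕ} {p : ℕ → X} (hp : LinkedChain U ε y N p) :
    LinkedChain U ε (p 0) N (fun i => p (N - i)) := by
  refine ⟨fun j => ?_, fun j hj => by simp [Nat.sub_eq_zero_of_le hj]⟩
  by_cases h : j < N
  · have h3 : N - j = N - (j + 1) + 1 := by omega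
    simpa only [h3] using (hp.1 (N - (j + 1))).symm
  · have h1 : N - j = 0 := by omega
    have h2 : N - (j + 1) = 0 := by omega
    simpa only [h1, h2] using (hp.1 0).refl_left

/-- Being joined by a chain is symmetric and transitive, and nearby points are linked, so a
preconnected set cannot split into several classes. -/
theorem exists_linkedChain [LocallyConnectedSpace X] (hU : IsOpen U) (hc : IsPreconnected U)
    (hε : 0 < ε) (hx : x ∈ U) (hy : y ∈ U) : ∃ N p, p 0 = x ∧ LinkedChain U ε y N p := by
  refine hc.induction₂ (fun x y => ∃ N p, p 0 = x ∧ LinkedChain U ε y N p) ?_ ?_ ?_ hx hy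
  · intro x hx
    refine nhdsWithin_le_nhds ?_
    filter_upwards [eventually_linked hU hx hε] with y hy
    refine ⟨1, fun i => if i = 0 then x else y, by simp, fun j => ?_, fun j hj => ?_⟩
    · by_cases h : j = 0
      · simpa [h] using hy
      · simpa [h] using hy.symm.refl_left
    · simp [Nat.one_le_iff_ne_zero.1 hj]
  · rintro x y z - - - ⟨N, p, rfl, hp⟩ ⟨M, q, hq0, hq⟩
    refine ⟨N + M, _, ?_, hp.trans hq hq0⟩
    by_cases h : 0 < N
    · simp [h]
    · simp [h, hq0, hp.2 0 (by omega)]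
  · rintro x y - - ⟨N, p, rfl, hp⟩
    exact ⟨N, _, by simp [hp.2 N le_rfl], hp.symm⟩

/-- Each link is replaced by a finer chain inside the connected open set that witnesses it, all of
one length `m`. The new point of index `i` then lies in the same set as the old point of index `i /
m`, which gives the distance bound. -/
theorem LinkedChain.exists_refinement [LocallyConnectedSpace X] {N : ℕ} {p : ℕ → X} {δ : ℝ}
    (hp : LinkedChain U ε y N p) (hδ : 0 < δ) :
    ∃ m p', 0 < m ∧ LinkedChain U δ y (N * m) p' ∧ p' 0 = p 0 ∧
      ∀ i, dist (p (i / m)) (p' i) ≤ ε := by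
  choose C hCo hCc hCU ha hb hd using hp.1
  choose n q hq0 hq using fun j => exists_linkedChain (hCo j) (hCc j) hδ (ha j) (hb j)
  obtain ⟨m, hm⟩ : ∃ m, ∀ j < N, n j ≤ m :=
    ⟨(Finset.range N).sup n, fun j hj => Finset.le_sup (Finset.mem_range.2 hj)⟩
  -- Chains that have become constant may be prolonged, so all links with `j < N` can share the
  -- length `m + 1`. Beyond `N` the bound on `n j` is not available, and the constant chain at `y`
  -- is used.
  have key : ∀ j, ∃ r : ℕ → X, r 0 = p j ∧ r (m + 1) = p (j + 1) ∧
      (∀ i, Linked (C j) δ (r i) (r (i + 1))) ∧ (N ≤ j → ∀ i, r i = y) := by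
    intro j
    rcases lt_or_ge j N with h | h
    · exact ⟨q j, hq0 j, (hq j).2 _ ((hm j h).trans m.le_succ), (hq j).1, fun h' => by omega⟩
    · have h0 := ((hq j).1 0).refl_left
      rw [hq0 j, hp.2 j h] at h0
      exact ⟨fun _ => y, (hp.2 j h).symm, (hp.2 (j + 1) (by omega)).symm, fun _ => h0,
        fun _ _ => rfl⟩
  choose r hr0 hrm hr hrN using key
  refine ⟨m + 1, fun i => r (i / (m + 1)) (i % (m + 1)), m.succ_pos, ⟨fun i => ?_, fun i hi => ?_⟩,
    by simp [hr0], fun i => ?_⟩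
  · have h1 := hr (i / (m + 1)) (i % (m + 1))
    refine Linked.mono ?_ (hCU (i / (m + 1)))
    rcases (Nat.succ_le_of_lt (Nat.mod_lt i m.succ_pos)).lt_or_eq with h | h
    · have e : i + 1 = (i % (m + 1) + 1) + (m + 1) * (i / (m + 1)) := by
        have := Nat.mod_add_div i (m + 1)
        omega
      have e1 : (i + 1) / (m + 1) = i / (m + 1) := by
        conv_lhs => rw [e, Nat.add_mul_div_left _ _ m.succ_pos, Nat.div_eq_of_lt h, zero_add]
      have e2 : (i + 1) % (m + 1) = i % (m + 1) + 1 := by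
        conv_lhs => rw [e, Nat.add_mul_mod_self_left, Nat.mod_eq_of_lt h]
      simpa only [e1, e2] using h1
    · have e : i + 1 = (m + 1) * (i / (m + 1) + 1) := by
        have := Nat.mod_add_div i (m + 1)
        have h' : i % (m + 1) + 1 = m + 1 := h
        linarith
      have e1 : (i + 1) / (m + 1) = i / (m + 1) + 1 := by
        conv_lhs => rw [e, Nat.mul_div_cancel_left _ m.succ_pos]
      have e2 : (i + 1) % (m + 1) = 0 := by
        conv_lhs => rw [e, Nat.mul_mod_right]
      have h' : i % (m + 1) + 1 = m + 1 := h
      rw [h', hrm, ← hr0] at h1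
      simpa only [e1, e2] using h1
  · exact hrN _ ((Nat.le_div_iff_mul_le m.succ_pos).2 hi) _
  · exact hd _ _ (ha _) _ (hr _ _).mem_left

/-- The integer parts of two numbers less than one apart differ by at most one, so at most one link
is crossed. -/
theorem dist_floor_le {p : ℕ → X} (h : ∀ j, dist (p j) (p (j + 1)) ≤ ε) {s t : ℝ}
    (hs : 0 ≤ s) (ht : 0 ≤ t) (hst : |s - t| < 1) : dist (p ⌊s⌋₊) (p ⌊t⌋₊) ≤ ε := by
  have hε : 0 ≤ ε := dist_nonneg.trans (h 0)
  rw [abs_lt] at hst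
  have h1 : ⌊s⌋₊ ≤ ⌊t⌋₊ + 1 := by
    rw [← Nat.floor_add_one ht]
    exact Nat.floor_mono (by linarith)
  have h2 : ⌊t⌋₊ ≤ ⌊s⌋₊ + 1 := by
    rw [← Nat.floor_add_one hs]
    exact Nat.floor_mono (by linarith)
  rcases (by omega : ⌊s⌋₊ = ⌊t⌋₊ ∨ ⌊s⌋₊ = ⌊t⌋₊ + 1 ∨ ⌊t⌋₊ = ⌊s⌋₊ + 1) with e | e | e
  · rwa [e, dist_self]
  · rw [e, dist_comm]
    exact h _
  · rw [e]
    exact h _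

/-- In a locally connected metric space, two points of a connected open set `U` are joined by a
path in every complete set containing `U`. -/
theorem joinedIn_of_isComplete [LocallyConnectedSpace X] {Q : Set X} (hU : IsOpen U)
    (hc : IsPreconnected U) (hQ : IsComplete Q) (hUQ : U ⊆ Q) (hx : x ∈ U) (hy : y ∈ U) :
    JoinedIn Q x y := by
  -- This form fits the criterion for Cauchy sequences with geometric bounds `C / 2 / 2 ^ k`, taken
  -- with `C = 1`.
  let ε : ℕ → ℝ := fun k => 1 / 2 / 2 ^ k
  have hε : ∀ k, 0 < ε k := fun k => by positivity
  let S : ℕ → Type _ := fun k =>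
    {s : ℕ × (ℕ → X) // 0 < s.1 ∧ s.2 0 = x ∧ LinkedChain U (ε k) y s.1 s.2}
  have s₀ : Nonempty (S 0) := by
    obtain ⟨N, p, hp0, hp⟩ := exists_linkedChain hU hc (hε 0) hx hy
    -- The length is raised by one to make it positive: the chains are parametrized by `t * N`, and
    -- continuity divides by `N`.
    exact ⟨⟨(N + 1, p), N.succ_pos, hp0, hp.1, fun j hj => hp.2 j (by omega)⟩⟩
  have step : ∀ k (s : S k), ∃ t : S (k + 1), ∃ m, 0 < m ∧ t.1.1 = s.1.1 * m ∧
      ∀ i, dist (s.1.2 (i / m)) (t.1.2 i) ≤ ε k := by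
    rintro k ⟨⟨N, p⟩, hN, h0, hp⟩
    obtain ⟨m, p', hm, hp', h0', hd⟩ := hp.exists_refinement (hε (k + 1))
    exact ⟨⟨(N * m, p'), Nat.mul_pos hN hm, h0'.trans h0, hp'⟩, m, hm, rfl, hd⟩
  choose next m hm hN hd using step
  let s : ∀ k, S k := fun k => Nat.rec s₀.some next k
  let F : ℕ → ℝ → X := fun k t => (s k).1.2 ⌊t * (s k).1.1⌋₊
  have hF : ∀ t k, dist (F k t) (F (k + 1) t) ≤ 1 / 2 / 2 ^ k := by
    intro t k
    have h1 := hd k (s k) ⌊t * (s (k + 1)).1.1⌋₊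
    -- The new length is `m` times the old one, so at a fixed time `t` the fine index lies in the
    -- block of the coarse index.
    have h2 : ⌊t * (s (k + 1)).1.1⌋₊ / m k (s k) = ⌊t * (s k).1.1⌋₊ := by
      have h3 : ((m k (s k) : ℕ) : ℝ) ≠ 0 := Nat.cast_ne_zero.2 (hm k (s k)).ne'
      have h4 : (s (k + 1)).1.1 = (s k).1.1 * m k (s k) := hN k (s k)
      rw [← Nat.floor_div_natCast, h4, Nat.cast_mul, ← mul_assoc, mul_div_cancel_right₀ _ h3]
    rw [h2] at h1
    exact h1
  have hFQ : ∀ t k, F k t ∈ Q := fun t k => hUQ ((s k).2.2.2.1 _).mem_left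
  have hlim : ∀ t, ∃ z ∈ Q, Tendsto (fun k => F k t) atTop (𝓝 z) := fun t =>
    cauchySeq_tendsto_of_isComplete hQ (hFQ t) (cauchySeq_of_le_geometric_two (hF t))
  choose f hfQ hf using hlim
  have hdist : ∀ t k, dist (F k t) (f t) ≤ 1 / 2 ^ k := fun t k =>
    dist_le_of_le_geometric_two_of_tendsto (hF t) (hf t) k
  refine JoinedIn.ofLine (f := f) ?_ ?_ ?_ ?_
  · refine Metric.continuousOn_iff.2 fun t ht δ hδ => ?_
    obtain ⟨k, hk⟩ := exists_pow_lt_of_lt_one (by positivity : 0 < δ / 3)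
      (by norm_num : (1 / 2 : ℝ) < 1)
    rw [one_div_pow] at hk
    have hNk : (0 : ℝ) < (s k).1.1 := Nat.cast_pos.2 (s k).2.1
    -- Times closer than `1 / N` move the index of the `k`-th chain by at most one. The distance
    -- from `f t'` to `f t` is then a sum of three terms, each at most `1 / 2 ^ k < δ / 3`.
    refine ⟨1 / (s k).1.1, by positivity, fun t' ht' htt' => ?_⟩
    rw [Real.dist_eq, lt_div_iff₀ hNk] at htt'
    have h1 : dist (F k t') (F k t) ≤ ε k := by
      refine dist_floor_le (fun j => ((s k).2.2.2.1 j).dist_le) (mul_nonneg ht'.1 hNk.le)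
        (mul_nonneg ht.1 hNk.le) ?_
      rwa [← sub_mul, abs_mul, abs_of_pos hNk]
    have h2 : ε k ≤ 1 / 2 ^ k := by
      have : (0 : ℝ) < 1 / 2 ^ k := by positivity
      have : ε k = 1 / 2 ^ k / 2 := by simp only [ε]; ring
      linarith
    have h3 := hdist t' k
    have h4 := hdist t k
    rw [dist_comm] at h3
    linarith [dist_triangle4 (f t') (F k t') (F k t) (f t)]
  · refine tendsto_nhds_unique (hf 0) ?_
    have : (fun k => F k 0) = fun _ => x := by
      funext k
      simpa [F] using (s k).2.2.1
    rw [this]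
    exact tendsto_const_nhds
  · refine tendsto_nhds_unique (hf 1) ?_
    have : (fun k => F k 1) = fun _ => y := by
      funext k
      simpa [F] using (s k).2.2.2.2 _ le_rfl
    rw [this]
    exact tendsto_const_nhds
  · rintro _ ⟨t, -, rfl⟩
    exact hfQ t

end PathConnected

/-- A locally connected, locally compact metrizable space is locally path-connected. -/
theorem locallyPathConnectedSpace_of_metrizableSpace (X : Type u) [TopologicalSpace X]
    [MetrizableSpace X] [LocallyConnectedSpace X] [LocallyCompactSpace X] :
    LocallyPathConnectedSpace X := by
  let := metrizableSpaceMetric X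
  refine locallyPathConnectedSpace_iff_pathComponentIn_mem_nhds.2 fun x V hV hx => ?_
  obtain ⟨Q, hQ, hQV, hQc⟩ := local_compact_nhds (hV.mem_nhds hx)
  obtain ⟨U, hUQ, hUo, hxU, hUc⟩ :=
    locallyConnectedSpace_iff_subsets_isOpen_isConnected.1 ‹_› x Q hQ
  refine Filter.mem_of_superset (hUo.mem_nhds hxU) fun y hy => ?_
  exact (joinedIn_of_isComplete hUo hUc.isPreconnected hQc.isComplete hUQ hxU hy).mono hQV

/-! ### Unbounded components and the space of ends -/

section Components

open Topology

variable {X : Type u} [TopologicalSpace X] (K : CompactExhaustion X)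

/-- A component of the complement of `K i` either is contained in `K (i + 1)`, or meets the
frontier of `K (i + 1)`, or is the whole space. -/
theorem connectedComponentIn_compl_trichotomy [PreconnectedSpace X] [LocallyConnectedSpace X]
    [T2Space X] {i : ℕ} {x : X} (hx : x ∈ (K i)ᶜ) :
    connectedComponentIn (K i)ᶜ x ⊆ K (i + 1) ∨
      (connectedComponentIn (K i)ᶜ x ∩ frontier (K (i + 1))).Nonempty ∨
        connectedComponentIn (K i)ᶜ x = univ := by
  set C := connectedComponentIn (K i)ᶜ x with hC
  have hxC : x ∈ C := mem_connectedComponentIn hx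
  by_cases hF : (C ∩ frontier (K (i + 1))).Nonempty
  · exact Or.inr (Or.inl hF)
  -- A component that misses the frontier of `K (i + 1)` lies entirely inside its interior or
  -- entirely outside it.
  have hcover : C ⊆ interior (K (i + 1)) ∪ (K (i + 1))ᶜ := by
    intro z hz
    by_cases hzK : z ∈ K (i + 1)
    · by_contra h
      exact hF ⟨z, hz, subset_closure hzK, fun h' => h (Or.inl h')⟩
    · exact Or.inr hzK
  rcases isPreconnected_connectedComponentIn.subset_or_subset isOpen_interior
    (K.isCompact (i + 1)).isClosed.isOpen_compl
    (disjoint_compl_right.mono_left interior_subset) hcover with h | h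
  · exact Or.inl (h.trans interior_subset)
  refine Or.inr (Or.inr ?_)
  -- A component outside `K (i + 1)` stays away from `K i` even after closure, so by maximality it
  -- is closed. Being also open, it is the whole space.
  have hcl : closure C ⊆ (K i)ᶜ := by
    have h1 : closure C ⊆ (interior (K (i + 1)))ᶜ :=
      closure_minimal (h.trans (compl_subset_compl.2 interior_subset))
        isOpen_interior.isClosed_compl
    exact h1.trans (compl_subset_compl.2 (K.subset_interior_succ i))
  have hclosed : IsClosed C := isClosed_of_closure_subset
    (isPreconnected_connectedComponentIn.closure.subset_connectedComponentIn
      (subset_closure hxC) hcl)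
  exact IsClopen.eq_univ ⟨hclosed, (K.isCompact i).isClosed.isOpen_compl.connectedComponentIn⟩
    ⟨x, hxC⟩

/-- Only finitely many components of the complement of `K i` are not contained in `K (i + 1)`. -/
theorem finite_components_not_subset [PreconnectedSpace X] [LocallyConnectedSpace X]
    [T2Space X] (i : ℕ) :
    {C | (∃ x ∈ (K i)ᶜ, C = connectedComponentIn (K i)ᶜ x) ∧ ¬ C ⊆ K (i + 1)}.Finite := by
  have hF : frontier (K (i + 1)) ⊆ (K i)ᶜ := fun z hz hzK =>
    hz.2 (K.subset_interior_succ i hzK)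
  have hFc : IsCompact (frontier (K (i + 1))) :=
    (K.isCompact (i + 1)).of_isClosed_subset isClosed_frontier
      (K.isCompact (i + 1)).isClosed.frontier_subset
  obtain ⟨t, -, ht⟩ := hFc.elim_nhds_subcover (connectedComponentIn (K i)ᶜ) fun z hz =>
    connectedComponentIn_mem_nhds ((K.isCompact i).isClosed.isOpen_compl.mem_nhds (hF hz))
  -- `univ` is inserted for the case where the component is the whole space, which can occur when `K
  -- i` is empty.
  refine ((t.finite_toSet.image (connectedComponentIn (K i)ᶜ)).insert univ).subset ?_
  rintro _ ⟨⟨x, hx, rfl⟩, hsub⟩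
  rcases connectedComponentIn_compl_trichotomy K hx with h | ⟨z, hz, hzF⟩ | h
  · exact absurd h hsub
  · obtain ⟨y, hy, hzy⟩ := mem_iUnion₂.1 (ht hzF)
    exact Or.inr ⟨y, hy, by rw [connectedComponentIn_eq hz, connectedComponentIn_eq hzy]⟩
  · exact Or.inl h

theorem finite_unboundedComponents [PreconnectedSpace X] [LocallyConnectedSpace X]
    [T2Space X] (i : ℕ) : (unboundedComponents (K i)ᶜ).Finite :=
  (finite_components_not_subset K i).subset fun _ hC =>
    ⟨hC.1, fun h => hC.2 ((K.isCompact (i + 1)).closure_of_subset h)⟩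

/-- The union of the bounded components of the complement of `K i` is relatively compact. -/
theorem exists_forall_mem_unboundedComponents [PreconnectedSpace X] [LocallyConnectedSpace X]
    [T2Space X] [WeaklyLocallyCompactSpace X] (i : ℕ) :
    ∃ j, i ≤ j ∧ ∀ x ∈ (K j)ᶜ, connectedComponentIn (K i)ᶜ x ∈ unboundedComponents (K i)ᶜ := by
  have hfin : {C | ((∃ x ∈ (K i)ᶜ, C = connectedComponentIn (K i)ᶜ x) ∧ ¬ C ⊆ K (i + 1)) ∧
      IsCompact (closure C)}.Finite :=
    (finite_components_not_subset K i).subset fun _ hC => hC.1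
  -- A bounded component either lies in `K (i + 1)` or is one of finitely many others with compact
  -- closure, so a single `K j` contains them all.
  obtain ⟨j, hj⟩ := K.exists_superset_of_isCompact
    ((K.isCompact (i + 1)).union (hfin.isCompact_biUnion fun C hC => hC.2))
  refine ⟨max i j, le_max_left i j, fun x hx => ?_⟩
  have hxi : x ∈ (K i)ᶜ := fun h => hx (K.subset (le_max_left i j) h)
  have hxC := mem_connectedComponentIn hxi
  refine ⟨⟨x, hxi, rfl⟩, fun hcomp => hx (K.subset (le_max_right i j) (hj ?_))⟩
  by_cases h : connectedComponentIn (K i)ᶜ x ⊆ K (i + 1)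
  · exact Or.inl (h hxC)
  · exact Or.inr (mem_iUnion₂.2 ⟨_, ⟨⟨⟨x, hxi, rfl⟩, h⟩, hcomp⟩, subset_closure hxC⟩)

/-- The inductive step for extending a component to an end: `C` has points far enough out that their
components at the next level are unbounded. -/
theorem exists_unboundedComponent_subset [PreconnectedSpace X] [LocallyConnectedSpace X]
    [T2Space X] [WeaklyLocallyCompactSpace X] {i : ℕ} {C : Set X}
    (hC : C ∈ unboundedComponents (K i)ᶜ) :
    ∃ D ∈ unboundedComponents (K (i + 1))ᶜ, D ⊆ C := by
  obtain ⟨j, -, hj⟩ := exists_forall_mem_unboundedComponents K (i + 1)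
  obtain ⟨x, hxC, hx⟩ := not_subset.1 fun h => hC.2 ((K.isCompact j).closure_of_subset h)
  refine ⟨_, hj x hx, ?_⟩
  obtain ⟨y, hy, rfl⟩ := hC.1
  rw [connectedComponentIn_eq hxC]
  exact connectedComponentIn_mono _ (compl_subset_compl.2 (K.subset_succ i))

/-! ### Existence of ends, neighbourhoods of an end, and compactness of the end space. -/

namespace EndSpace

variable {K}

theorem term_isPreconnected (ε : EndSpace K) (i : ℕ) : IsPreconnected (ε.term i) := by
  obtain ⟨⟨x, -, h⟩, -⟩ := ε.term_mem i
  exact h ▸ isPreconnected_connectedComponentIn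

theorem term_isOpen [LocallyConnectedSpace X] [T2Space X] (ε : EndSpace K) (i : ℕ) :
    IsOpen (ε.term i) := by
  obtain ⟨⟨x, -, h⟩, -⟩ := ε.term_mem i
  exact h ▸ (K.isCompact i).isClosed.isOpen_compl.connectedComponentIn

theorem term_subset_compl (ε : EndSpace K) (i : ℕ) : ε.term i ⊆ (K i)ᶜ := by
  obtain ⟨⟨x, -, h⟩, -⟩ := ε.term_mem i
  exact h ▸ connectedComponentIn_subset _ _

/-- Later terms of an end determine the earlier ones. -/
theorem term_eq_of_le {ε ε' : EndSpace K} {i j : ℕ} (hij : i ≤ j) (h : ε.term j = ε'.term j) :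
    ε.term i = ε'.term i := by
  obtain ⟨x, hx⟩ := ε.term_nonempty j
  exact eq_of_mem_of_mem (ε.term_mem i) (ε'.term_mem i) (ε.term_subset_of_le hij hx)
    (ε'.term_subset_of_le hij (h ▸ hx))

/-- Every unbounded component of the complement of `K i` is the `i`-th term of an end. -/
theorem exists_term_eq [PreconnectedSpace X] [LocallyConnectedSpace X]
    [T2Space X] [WeaklyLocallyCompactSpace X] {i : ℕ} {C : Set X}
    (hC : C ∈ unboundedComponents (K i)ᶜ) : ∃ ε : EndSpace K, ε.term i = C := by
  choose next hnext using fun (j : ℕ) (D : unboundedComponents (K j)ᶜ) =>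
    exists_unboundedComponent_subset K D.2
  -- `D n` sits at level `i + n`, but the `n`-th term of the end is the component at level `n` that
  -- contains it. This shift treats the indices below `i` and those above it alike.
  let D : ∀ n, unboundedComponents (K (i + n))ᶜ := fun n =>
    Nat.rec ⟨C, hC⟩ (fun n E => ⟨next (i + n) E, (hnext (i + n) E).1⟩) n
  have hDsucc : ∀ n, (D (n + 1)).1 ⊆ (D n).1 := fun n => (hnext (i + n) (D n)).2
  have hne : ∀ n, (D n).1.Nonempty := by
    intro n
    obtain ⟨⟨x, hx, h⟩, -⟩ := (D n).2
    exact ⟨x, h ▸ mem_connectedComponentIn hx⟩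
  choose x hx using hne
  have hcompl : ∀ n, (D n).1 ⊆ (K n)ᶜ := by
    intro n
    obtain ⟨⟨x, -, h⟩, -⟩ := (D n).2
    exact h ▸ (connectedComponentIn_subset _ _).trans
      (compl_subset_compl.2 (K.subset (Nat.le_add_left n i)))
  have hsub : ∀ n, (D n).1 ⊆ connectedComponentIn (K n)ᶜ (x n) := by
    intro n
    refine IsPreconnected.subset_connectedComponentIn ?_ (hx n) (hcompl n)
    obtain ⟨⟨x, -, h⟩, -⟩ := (D n).2
    exact h ▸ isPreconnected_connectedComponentIn
  have hmem : ∀ n, connectedComponentIn (K n)ᶜ (x n) ∈ unboundedComponents (K n)ᶜ := fun n =>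
    ⟨⟨x n, hcompl n (hx n), rfl⟩, fun h => (D n).2.2
      (h.closure_of_subset ((hsub n).trans subset_closure))⟩
  let ε : EndSpace K :=
    { term := fun n => connectedComponentIn (K n)ᶜ (x n)
      term_mem := hmem
      term_succ_subset := fun n => by
        rw [connectedComponentIn_eq (hsub n (hDsucc n (hx (n + 1))))]
        exact connectedComponentIn_mono _ (compl_subset_compl.2 (K.subset_succ n)) }
  exact ⟨ε, eq_of_mem_of_mem (ε.term_mem i) hC (hsub i (hx i))
    (antitone_nat_of_succ_le (f := fun n => (D n).1) hDsucc (Nat.zero_le i) (hx i))⟩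

theorem isOpen_basicOpen (ε : EndSpace K) (i : ℕ) : IsOpen (basicOpen K i (ε.term i)) :=
  isOpen_generateFrom_of_mem ⟨i, _, ε.term_mem i, rfl⟩

/-- Later terms determine earlier ones, so the basic open sets around `ε` are nested and the
generating family needs no finite intersections. -/
theorem hasBasis_nhds (ε : EndSpace K) :
    (𝓝 ε).HasBasis (fun _ : ℕ => True) (fun i => basicOpen K i (ε.term i)) := by
  have h : 𝓝 ε = ⨅ i, Filter.principal (basicOpen K i (ε.term i)) := by
    refine le_antisymm (le_iInf fun i => Filter.le_principal_iff.2
      ((isOpen_basicOpen ε i).mem_nhds rfl)) ?_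
    rw [nhds_generateFrom]
    refine le_iInf₂ fun s hs => ?_
    obtain ⟨hε, i, C, -, rfl⟩ := hs
    obtain rfl : ε.term i = C := hε
    exact iInf_le _ i
  rw [h]
  refine Filter.hasBasis_iInf_principal (Antitone.directed_ge fun i j hij ε' h => ?_)
  exact term_eq_of_le hij h

/-- At each level the end space is a finite union of basic open sets, so an ultrafilter selects one
component per level. Two consecutive selections share an end and are therefore nested, and the
resulting end is a limit. -/
instance compactSpace [PreconnectedSpace X] [LocallyConnectedSpace X] [T2Space X] :
    CompactSpace (EndSpace K) := by
  refine ⟨isCompact_iff_ultrafilter_le_nhds.2 fun F _ => ?_⟩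
  have h : ∀ i, ∃ C ∈ unboundedComponents (K i)ᶜ, basicOpen K i C ∈ F := fun i =>
    (Ultrafilter.finite_biUnion_mem_iff (finite_unboundedComponents K i)).1
      (Filter.mem_of_superset Filter.univ_mem fun ε _ => mem_iUnion₂.2 ⟨_, ε.term_mem i, rfl⟩)
  choose C hC hCF using h
  refine ⟨⟨C, hC, fun i => ?_⟩, mem_univ _, (hasBasis_nhds _).ge_iff.2 fun i _ => hCF i⟩
  obtain ⟨ε, h1, h2⟩ := Ultrafilter.nonempty_of_mem (Filter.inter_mem (hCF i) (hCF (i + 1)))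
  have h1 : ε.term i = C i := h1
  have h2 : ε.term (i + 1) = C (i + 1) := h2
  exact h1 ▸ h2 ▸ ε.term_succ_subset i

/-- A continuous function from the space of ends to a discrete space factors through the terms of
some index. -/
theorem exists_eq_of_term_eq [PreconnectedSpace X] [LocallyConnectedSpace X] [T2Space X]
    {R : Type*} [TopologicalSpace R] [DiscreteTopology R] (g : C(EndSpace K, R)) :
    ∃ i, ∀ ε ε' : EndSpace K, ε.term i = ε'.term i → g ε = g ε' := by
  have h : ∀ ε : EndSpace K, ∃ i, ∀ ε', ε'.term i = ε.term i → g ε' = g ε := by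
    intro ε
    obtain ⟨i, -, hi⟩ := (hasBasis_nhds ε).mem_iff.1
      (((isOpen_discrete {g ε}).preimage g.continuous).mem_nhds rfl)
    exact ⟨i, fun ε' h => hi h⟩
  choose i hi using h
  -- Finitely many of the neighbourhoods on which `g` is constant cover the end space, and the
  -- largest of their levels works for all ends.
  obtain ⟨t, -, ht⟩ := isCompact_univ.elim_nhds_subcover
    (fun ε : EndSpace K => basicOpen K (i ε) (ε.term (i ε)))
    fun ε _ => (isOpen_basicOpen ε (i ε)).mem_nhds rfl
  refine ⟨t.sup i, fun ε ε' h => ?_⟩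
  obtain ⟨δ, hδ, hεδ⟩ := mem_iUnion₂.1 (ht (mem_univ ε))
  have hεδ : ε.term (i δ) = δ.term (i δ) := hεδ
  rw [hi δ ε hεδ, hi δ ε' ((term_eq_of_le (Finset.le_sup hδ) h).symm.trans hεδ)]

end EndSpace

end Components

/-! ### Evaluation of cohomology classes of degree zero at points -/

section Evaluation

variable (R : Type w) [CommRing R]
variable {X : Type u} [TopologicalSpace X] {Y : Type v} [TopologicalSpace Y]

theorem singularSimplex_zero_eq_const (σ : SingularSimplex X 0) :
    σ = ContinuousMap.const _ (σ default) := by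
  ext s
  exact congrArg σ (Subsingleton.elim _ _)

/-- Evaluation of a cohomology class of degree zero at a point. -/
noncomputable def evalAt (x : X) : Cohomology R X 0 →ₐ[R] R :=
  AlgHom.ofLinearMap
    (show Cohomology R X 0 →ₗ[R] R from
      Submodule.liftQ ((coboundaries R X 0).comap (cocycles R X 0).subtype)
        ((LinearMap.proj (ContinuousMap.const _ x : SingularSimplex X 0)).comp
          (cocycles R X 0).subtype)
        (fun φ h => by
          have h' : φ.1 = 0 := h
          simp [h']))
    rfl
    (fun a b => by
      obtain ⟨φ, rfl⟩ := cohomologyClass_surjective R _ 0 a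
      obtain ⟨ψ, rfl⟩ := cohomologyClass_surjective R _ 0 b
      rw [mk_mul_mk' R φ ψ (mul_mem_cocycles_zero R _ _)]
      rfl)

theorem evalAt_cohomologyMapZero (f : C(Y, X)) (y : Y) (a : Cohomology R X 0) :
    evalAt R y (cohomologyMapZero R f a) = evalAt R (f y) a := by
  obtain ⟨φ, rfl⟩ := cohomologyClass_surjective R _ 0 a
  rfl

/-- A singular `0`-simplex is a point, so a degree-zero cocycle is determined by its values at
points. -/
theorem eq_zero_of_evalAt_eq_zero (a : Cohomology R X 0) (h : ∀ x, evalAt R x a = 0) : a = 0 := by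
  obtain ⟨φ, rfl⟩ := cohomologyClass_surjective R _ 0 a
  have : φ = 0 := by
    ext σ
    rw [singularSimplex_zero_eq_const σ]
    exact h _
  rw [this, map_zero]

/-- The singular `1`-simplex given by a path. -/
noncomputable def pathSimplex {x y : X} (γ : Path x y) : SingularSimplex X 1 :=
  γ.toContinuousMap.comp ⟨stdSimplexHomeomorphUnitInterval, Homeomorph.continuous _⟩

theorem face_eq_const (σ : SingularSimplex X 1) (i : Fin 2) :
    σ.comp (vertexMap (Fin.succAbove i)) =
      (ContinuousMap.const _ (σ (stdSimplex.vertex (i.succAbove 0))) : SingularSimplex X 0) := by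
  ext s
  have hs : s = stdSimplex.vertex 0 := Subsingleton.elim _ _
  subst hs
  exact congrArg σ (stdSimplex.map_vertex _ _)

/-- A path is a singular `1`-simplex, and a degree-zero cocycle agrees on its two faces. -/
theorem evalAt_eq_of_joined {x y : X} (h : Joined x y) (a : Cohomology R X 0) :
    evalAt R x a = evalAt R y a := by
  obtain ⟨γ⟩ := h
  obtain ⟨φ, rfl⟩ := cohomologyClass_surjective R _ 0 a
  have h := (mem_cocycles_zero_iff R φ.1).1 φ.2 (pathSimplex γ)
  rw [face_eq_const, face_eq_const] at h
  -- The `i`-th face is the vertex opposite to `i`: face `1` is the source of the path and face `0`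
  -- its target.
  have h0 : pathSimplex γ (stdSimplex.vertex (Fin.succAbove 1 0)) = x :=
    (congrArg γ stdSimplexHomeomorphUnitInterval_zero).trans γ.source
  have h1 : pathSimplex γ (stdSimplex.vertex (Fin.succAbove 0 0)) = y :=
    (congrArg γ stdSimplexHomeomorphUnitInterval_one).trans γ.target
  rw [h0, h1] at h
  exact h.symm

/-- Metrizability and local compactness enter here: they make the connected open set `C`
path-connected. -/
theorem evalAt_eq_of_isPreconnected [MetrizableSpace X] [LocallyConnectedSpace X]
    [LocallyCompactSpace X] {A C : Set X} (hCo : IsOpen C) (hC : IsPreconnected C) (hCA : C ⊆ A)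
    {x y : A} (hx : (x : X) ∈ C) (hy : (y : X) ∈ C) (a : Cohomology R A 0) :
    evalAt R x a = evalAt R y a := by
  have := locallyPathConnectedSpace_of_metrizableSpace X
  have h := (hCo.isConnected_iff_isPathConnected.1 ⟨⟨x, hx⟩, hC⟩).joinedIn x hx y hy
  exact evalAt_eq_of_joined R (h.mono hCA).joined_subtype a

/-- A function which takes the same value at any two joined points defines a cohomology class. -/
theorem exists_evalAt_eq (g : X → R) (hg : ∀ x y, Joined x y → g x = g y) :
    ∃ a : Cohomology R X 0, ∀ x, evalAt R x a = g x := by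
  refine ⟨cohomologyClass R X 0 ⟨fun σ => g (σ default), ?_⟩, fun x => rfl⟩
  rw [mem_cocycles_zero_iff]
  intro σ
  rw [face_eq_const, face_eq_const]
  refine hg _ _ ?_
  -- The standard simplex is convex, so the endpoints of every singular `1`-simplex are joined in
  -- `X`.
  have hj : ∀ s t : stdSimplex ℝ (Fin 2), Joined s t := by
    intro s t
    exact (((convex_stdSimplex ℝ (Fin 2)).isPathConnected ⟨s, s.2⟩).joinedIn s s.2 t
      t.2).joined_subtype
  exact (hj _ _).map σ.continuous

/-! ### The value of a class along an end. -/

theorem exists_endPoint (K : CompactExhaustion X) (A : Compacts X) (ε : EndSpace K) :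
    ∃ x : ↥(A : Set X)ᶜ, ∃ i, (A : Set X) ⊆ K i ∧ (x : X) ∈ ε.term i := by
  obtain ⟨i, hi⟩ := K.exists_superset_of_isCompact A.isCompact
  obtain ⟨x, hx⟩ := ε.term_nonempty i
  exact ⟨⟨x, fun h => ε.term_subset_compl i hx (hi h)⟩, i, hi, hx⟩

theorem evalAt_eq_of_mem_term [MetrizableSpace X] [LocallyConnectedSpace X]
    [LocallyCompactSpace X] (K : CompactExhaustion X) (A : Compacts X) (ε : EndSpace K) {i j : ℕ}
    (hi : (A : Set X) ⊆ K i) (hj : (A : Set X) ⊆ K j) {x y : ↥(A : Set X)ᶜ}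
    (hx : (x : X) ∈ ε.term i) (hy : (y : X) ∈ ε.term j) (a : Cohomology R ↥(A : Set X)ᶜ 0) :
    evalAt R x a = evalAt R y a := by
  wlog hij : i ≤ j generalizing i j x y
  · exact (this hj hi hy hx (le_of_not_ge hij)).symm
  exact evalAt_eq_of_isPreconnected R (ε.term_isOpen i) (ε.term_isPreconnected i)
    ((ε.term_subset_compl i).trans (compl_subset_compl.2 hi)) hx (ε.term_subset_of_le hij hy) a

theorem evalAt_endPoint [MetrizableSpace X] [LocallyConnectedSpace X]
    [LocallyCompactSpace X] (K : CompactExhaustion X) (A : Compacts X) (ε : EndSpace K) {i : ℕ} (hi : (A : Set X) ⊆ K i)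
    {x : ↥(A : Set X)ᶜ} (hx : (x : X) ∈ ε.term i) (a : Cohomology R ↥(A : Set X)ᶜ 0) :
    evalAt R (exists_endPoint K A ε).choose a = evalAt R x a := by
  obtain ⟨j, hj, hy⟩ := (exists_endPoint K A ε).choose_spec
  exact evalAt_eq_of_mem_term R K A ε hj hi hy hx a

theorem exists_toEnd_eq (a : EndCohomologyZero R X) : ∃ A b, toEnd R X A b = a :=
  DirectLimit.induction _ (fun A b => ⟨A, b, rfl⟩) a

end Evaluation

/-! ### The isomorphism -/

section Iso

variable (R : Type w) [CommRing R] [TopologicalSpace R] [DiscreteTopology R]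
variable {X : Type u} [TopologicalSpace X] [GeneralizedContinuum X] [MetrizableSpace X]
variable (K : CompactExhaustion X)

/-- The function on ends given by a class in `H^0(X - A; R)`: its value at `ε` is the value of the
class at the points of the terms of `ε` of large index. -/
noncomputable def endValue (A : Compacts X) :
    Cohomology R ↥(A : Set X)ᶜ 0 →ₐ[R] C(EndSpace K, R) where
  toFun a :=
    { toFun := fun ε => evalAt R (exists_endPoint K A ε).choose a
      continuous_toFun := by
        refine IsLocallyConstant.continuous ((IsLocallyConstant.iff_exists_open _).2 fun ε => ?_)
        -- The point `x` computes the value at every end with the same `i`-th term, so the function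
        -- is constant on a basic neighbourhood of `ε`.
        obtain ⟨x, i, hi, hx⟩ := exists_endPoint K A ε
        refine ⟨_, EndSpace.isOpen_basicOpen ε i, rfl, fun ε' hε' => ?_⟩
        have hε' : ε'.term i = ε.term i := hε'
        rw [evalAt_endPoint R K A ε hi hx, evalAt_endPoint R K A ε' hi (hε' ▸ hx)] }
  map_one' := by ext; simp
  map_mul' a b := by ext; simp
  map_zero' := by ext; simp
  map_add' a b := by ext; simp
  commutes' r := by ext; simp

theorem endValue_apply (A : Compacts X) (ε : EndSpace K) {i : ℕ} (hi : (A : Set X) ⊆ K i)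
    {x : ↥(A : Set X)ᶜ} (hx : (x : X) ∈ ε.term i) (a : Cohomology R ↥(A : Set X)ᶜ 0) :
    endValue R K A a ε = evalAt R x a :=
  evalAt_endPoint R K A ε hi hx a

theorem endValue_restriction (A B : Compacts X) (h : A ≤ B) (a : Cohomology R ↥(A : Set X)ᶜ 0) :
    endValue R K B (restriction R X A B h a) = endValue R K A a := by
  ext ε
  obtain ⟨x, i, hi, hx⟩ := exists_endPoint K B ε
  have hA : (A : Set X) ⊆ K i := fun z hz => hi (h hz)
  rw [endValue_apply R K B ε hi hx]
  unfold restriction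
  rw [evalAt_cohomologyMapZero]
  exact (endValue_apply R K A ε hA hx a).symm

/-- The morphism `H_e^0(X; R) → C(E(X), R)`. -/
noncomputable def endHom : EndCohomologyZero R X →ₐ[R] C(EndSpace K, R) :=
  let F : EndCohomologyZero R X →ₗ[R] C(EndSpace K, R) :=
    DirectLimit.Module.lift R (Compacts X)
      (fun A : Compacts X => Cohomology R ↥(A : Set X)ᶜ 0) (fun A B h => restriction R X A B h)
      (fun A => (endValue R K A).toLinearMap)
      (fun A B h a => endValue_restriction R K A B h a)
  have hF : ∀ A a, F (toEnd R X A a) = endValue R K A a := fun _ _ => rfl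
  AlgHom.ofLinearMap F
    (by rw [← map_one (toEnd R X ⊥), hF, map_one])
    -- Two elements of the direct limit are represented over a common compact set, where
    -- multiplicativity is already known.
    (fun x y => DirectLimit.induction₂ _ (fun A a b => by
        change F (toEnd R X A a * toEnd R X A b) = F (toEnd R X A a) * F (toEnd R X A b)
        rw [← map_mul, hF, hF, hF, map_mul]) x y)

theorem endHom_toEnd (A : Compacts X) (a : Cohomology R ↥(A : Set X)ᶜ 0) :
    endHom R K (toEnd R X A a) = endValue R K A a :=
  rfl

/-- Every point off a large `K j` lies in an unbounded component of `X - K i`, and that component is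
the `i`-th term of some end. A class with value zero at all ends thus restricts to zero on `X - K j`
and vanishes in the limit. -/
theorem endHom_injective : Function.Injective (endHom R K) := by
  refine (injective_iff_map_eq_zero _).2 fun a ha => ?_
  obtain ⟨A, b, rfl⟩ := exists_toEnd_eq R a
  rw [endHom_toEnd] at ha
  obtain ⟨i, hi⟩ := K.exists_superset_of_isCompact A.isCompact
  obtain ⟨j, hij, hj⟩ := exists_forall_mem_unboundedComponents K i
  have hAj : A ≤ exhaustionCompact K j := hi.trans (K.subset hij)
  rw [← toEnd_restriction R X A (exhaustionCompact K j) hAj]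
  rw [eq_zero_of_evalAt_eq_zero R (restriction R X A (exhaustionCompact K j) hAj b), map_zero]
  intro x
  unfold restriction
  rw [evalAt_cohomologyMapZero]
  obtain ⟨ε, hε⟩ := EndSpace.exists_term_eq (hj x x.2)
  have hx : (x : X) ∈ ε.term i :=
    hε ▸ mem_connectedComponentIn fun h => x.2 (K.subset hij h)
  exact (endValue_apply R K A ε hi hx b).symm.trans (by rw [ha]; rfl)

theorem endHom_surjective : Function.Surjective (endHom R K) := by
  classical
  intro g
  obtain ⟨i, hi⟩ := EndSpace.exists_eq_of_term_eq g
  -- The value `0` is taken on the bounded components, which are not terms of any end. The choice of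
  -- end does not matter, since `g` depends only on the `i`-th term.
  let G : ↥(exhaustionCompact K i : Set X)ᶜ → R := fun x =>
    if h : ∃ ε : EndSpace K, (x : X) ∈ ε.term i then g h.choose else 0
  have hG : ∀ (ε : EndSpace K) (x : ↥(exhaustionCompact K i : Set X)ᶜ),
      (x : X) ∈ ε.term i → G x = g ε := by
    intro ε x hx
    have h : ∃ ε : EndSpace K, (x : X) ∈ ε.term i := ⟨ε, hx⟩
    simp only [G, dif_pos h]
    exact hi _ _ (EndSpace.eq_of_mem_of_mem (h.choose.term_mem i) (ε.term_mem i) h.choose_spec hx)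
  -- A path in `X - K i` stays in one component, so `G` is constant along paths and defines a
  -- cocycle.
  have hjoin : ∀ x y : ↥(exhaustionCompact K i : Set X)ᶜ, Joined x y →
      ∀ ε : EndSpace K, (x : X) ∈ ε.term i → (y : X) ∈ ε.term i := by
    rintro x y ⟨γ⟩ ε hx
    obtain ⟨⟨z, hz, h⟩, -⟩ := ε.term_mem i
    rw [h] at hx ⊢
    rw [connectedComponentIn_eq hx]
    refine (isPreconnected_range
      (continuous_subtype_val.comp γ.continuous)).subset_connectedComponentIn
      (x := (x : X)) ⟨0, by simp⟩ ?_ ⟨1, by simp⟩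
    rintro _ ⟨t, rfl⟩
    exact (γ t).2
  obtain ⟨a, ha⟩ := exists_evalAt_eq R G fun x y hxy => by
    by_cases h : ∃ ε : EndSpace K, (x : X) ∈ ε.term i
    · obtain ⟨ε, hε⟩ := h
      rw [hG ε x hε, hG ε y (hjoin x y hxy ε hε)]
    · have h' : ¬ ∃ ε : EndSpace K, (y : X) ∈ ε.term i := fun ⟨ε, hε⟩ =>
        h ⟨ε, hjoin y x hxy.symm ε hε⟩
      simp only [G, dif_neg h, dif_neg h']
  refine ⟨toEnd R X (exhaustionCompact K i) a, ?_⟩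
  ext ε
  obtain ⟨x, hx⟩ := ε.term_nonempty i
  rw [endHom_toEnd, endValue_apply R K (exhaustionCompact K i) ε subset_rfl
    (x := ⟨x, ε.term_subset_compl i hx⟩) hx, ha]
  exact hG ε _ hx

/-- The isomorphism `H_e^0(X; R) ≃ C(E(X), R)`. -/
noncomputable def endEquiv : EndCohomologyZero R X ≃ₐ[R] C(EndSpace K, R) :=
  AlgEquiv.ofBijective (endHom R K) ⟨endHom_injective R K, endHom_surjective R K⟩

theorem endEquiv_toEnd (A : Compacts X) (a : Cohomology R ↥(A : Set X)ᶜ 0) :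
    endEquiv R K (toEnd R X A a) = endValue R K A a :=
  rfl

theorem endEquiv_naturality {Y : Type v} [TopologicalSpace Y] [GeneralizedContinuum Y]
    [MetrizableSpace Y] (L : CompactExhaustion Y) (f : C(Y, X)) (hf : IsProper f)
    (a : EndCohomologyZero R X) :
    endEquiv R L (endCohomologyMap R f hf a) =
      (endEquiv R K a).comp (EndSpace.map f hf L K) := by
  obtain ⟨A, b, rfl⟩ := exists_toEnd_eq R a
  rw [endCohomologyMap_toEnd, endEquiv_toEnd, endEquiv_toEnd]
  ext ε
  obtain ⟨i, hi⟩ := K.exists_superset_of_isCompact A.isCompact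
  obtain ⟨k, hk⟩ := L.exists_superset_of_isCompact (hf _ (K.isCompact i))
  have hAk : (preimageCompacts f hf A : Set Y) ⊆ L k := (preimage_mono hi).trans hk
  -- With `k` chosen so that `f` maps the `k`-th term of `ε` into the `i`-th term of its image, both
  -- sides evaluate `b` at `f y`.
  obtain ⟨y, hy⟩ := ε.term_nonempty k
  have hyA : y ∈ (preimageCompacts f hf A : Set Y)ᶜ := fun h => ε.term_subset_compl k hy (hAk h)
  rw [endValue_apply R L _ ε hAk (x := ⟨y, hyA⟩) hy]
  unfold complMap
  rw [evalAt_cohomologyMapZero]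
  exact (endValue_apply R K A _ hi
    (EndSpace.image_term_subset f hf L K ε hk (mem_image_of_mem f hy)) b).symm

end Iso

end EndTheory

theorem mainTheorem5 (R : Type w) [CommRing R] [IsDomain R] [IsPrincipalIdealRing R]
    [TopologicalSpace R] [DiscreteTopology R] :
    -- a family of `R`-algebra isomorphisms `η : H_e^0(X; R) → C(E(X), R)`
    ∃ η : ∀ (X : Type u) [TopologicalSpace X] [EndTheory.GeneralizedContinuum X]
        [TopologicalSpace.MetrizableSpace X] (K : CompactExhaustion X),
        EndTheory.EndCohomologyZero R X ≃ₐ[R] C(EndTheory.EndSpace K, R),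
      -- `η` sends the element represented by a cocycle `φ` on `X - K i` to the function on ends
      -- whose value at `ε` is the value of `φ` at any point of the `i`-th term of `ε`
      (∀ (X : Type u) [TopologicalSpace X] [EndTheory.GeneralizedContinuum X]
        [TopologicalSpace.MetrizableSpace X] (K : CompactExhaustion X) (i : ℕ)
        (φ : EndTheory.cocycles R ↥(EndTheory.exhaustionCompact K i : Set X)ᶜ 0)
        (ε : EndTheory.EndSpace K) (x : ↥(EndTheory.exhaustionCompact K i : Set X)ᶜ),
        (x : X) ∈ ε.term i →
          η X K (EndTheory.toEnd R X (EndTheory.exhaustionCompact K i)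
            (EndTheory.cohomologyClass R _ 0 φ)) ε = EndTheory.valueAt φ.1 x) ∧
      -- `η` is natural for proper maps
      (∀ (Y X : Type u) [TopologicalSpace Y] [EndTheory.GeneralizedContinuum Y]
        [TopologicalSpace.MetrizableSpace Y] [TopologicalSpace X]
        [EndTheory.GeneralizedContinuum X] [TopologicalSpace.MetrizableSpace X]
        (f : C(Y, X)) (hf : EndTheory.IsProper f)
        (L : CompactExhaustion Y) (K : CompactExhaustion X),
        (η Y L).toAlgHom.comp (EndTheory.endCohomologyMap R f hf) =
          (ContinuousMap.compRightAlgHom R R (EndTheory.EndSpace.map f hf L K)).comp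
            (η X K).toAlgHom) := by
  refine ⟨fun X _ _ _ K => EndTheory.endEquiv R K, ?_, ?_⟩
  · intro X _ _ _ K i φ ε x hx
    exact EndTheory.endValue_apply R K _ ε Set.Subset.rfl hx _
  · intro Y X _ _ _ _ _ _ f hf L K
    exact AlgHom.ext fun a => EndTheory.endEquiv_naturality R K L f hf a
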